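/- Let $p(k)$ denote Euler's partition function, with $p(0)=1$ and $p(k)=0$ for $k<0$; let $\phi$ be Euler's totient function, $\mu$ the Möbius function, $\lambda$ Liouville's function, $\Lambda$ von Mangoldt's function, $\omega(n)$ the number of distinct primes dividing $n$, and, for $t\in\mathbb{C}$, let $J_t(n)=n^t\prod_{q\mid n,\ q\text{ prime}}(1-q^{-t})$ be Jordan's totient function. Write $[P]=1$ if $P$ holds and $[P]=0$ otherwise. For integers $m\ge 0$ put $u_1=\left\lfloor\frac{\sqrt{24m+1}+1}{6}\right\rfloor$, $u_2=\left\lfloor\frac{\sqrt{24m+1}-1}{6}\right\rfloor$ and \begin{align*} B_{\phi,m} &= m+1-\tfrac18\Bigl(8-5(-1)^{u_1}-4\bigl(-2+(-1)^{u_1}+(-1)^{u_2}\bigr)m+2(-1)^{u_1}u_1(3u_1+2)+(-1)^{u_2}(6u_2^2+8u_2-3)\Bigr),\\ B_{\mu,m} &= [m=0]+\sum_{b=\pm1}\ \sum_{k=1}^{\lfloor(\sqrt{24m+25}-b)/6\rfloor}(-1)^k\,[\,m+1-k(3k+b)/2=1\,],\\ B_{\lambda,m} &= [\sqrt{m+1}\in\mathbb{Z}]-\sum_{b=\pm1}\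 \sum_{k=1}^{\lfloor(\sqrt{24m+1}-b)/6\rfloor}(-1)^{k+1}\,[\sqrt{m+1-k(3k+b)/2}\in\mathbb{Z}],\\ B_{\Lambda,m} &= \log(m+1)-\sum_{b=\pm1}\ \sum_{k=1}^{\lfloor(\sqrt{24m+1}-b)/6\rfloor}(-1)^{k+1}\log\bigl(m+1-k(3k+b)/2\bigr),\\ B_{|\mu|,m} &= 2^{\omega(m+1)}-\sum_{b=\pm1}\ \sum_{k=1}^{\lfloor(\sqrt{24m+1}-b)/6\rfloor}(-1)^{k+1}\,2^{\omega(m+1-k(3k+b)/2)},\\ B_{J_t,m} &= (m+1)^t-\sum_{b=\pm1}\ \sum_{k=1}^{\lfloor(\sqrt{24m+1}-b)/6\rfloor}(-1)^{k+1}\bigl(m+1-k(3k+b)/2\bigr)^t . \end{align*} Then for each $f\in\{\phi,\mu,\lambda,\Lambda,|\mu|\}$, and for $f=J_t$ with any $t\in\mathbb{C}$, and for every integer $n\ge1$, $$f(n)=\sum_{m=0}^{n-1}\sum_{d\mid n}p(d-m-1)\,\mu(n/d)\,B_{f,m}.$$ Consequently, for each such $f$ and every real $x$, the summatory function $\Sigma_{f,x}=\sum_{1\le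 n\le x}f(n)$ is given by $$\Sigma_{f,x}=\sum_{1\le n\le x}\ \sum_{m=0}^{n-1}\sum_{d\mid n}p(d-m-1)\,\mu(n/d)\,B_{f,m}.$$ -/

import Mathlib

namespace ExactFormulas

open Finset

/-- Euler's partition function `p(k)` for integer arguments, zero at negative `k`. -/
def partitionFn (k : ℤ) : ℕ :=
  if 0 ≤ k then Fintype.card (Nat.Partition k.toNat) else 0

/-- Jordan's totient function `J_t(n) = n^t ∏_{p ∣ n} (1 - p^{-t})` for `n ≥ 1` and a complex
parameter `t`. -/
noncomputable def jordanTotient (t : ℂ) (n : ℕ) : ℂ :=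
  (n : ℂ) ^ t * ∏ p ∈ n.primeFactors, (1 - (p : ℂ) ^ (-t))

/-- The bound `⌊(√x - b) / 6⌋`, used where the quotient is nonnegative. -/
noncomputable def kBound (x : ℝ) (b : ℤ) : ℕ := ⌊(√x - (b : ℝ)) / 6⌋₊

/-- The pentagonal number `k (3 k + b) / 2`, for `b = ±1`; the division is exact. -/
def pent (b : ℤ) (k : ℕ) : ℤ := (k : ℤ) * (3 * (k : ℤ) + b) / 2

/-- `f(m+1) - ∑_{b = ±1} ∑_{k=1}^{⌊(√(24m+1)-b)/6⌋} (-1)^{k+1} f(m+1-k(3k+b)/2)`. -/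
noncomputable def pentSum {R : Type*} [CommRing R] (f : ℤ → R) (m : ℕ) : R :=
  f ((m : ℤ) + 1) - ∑ b ∈ ({1, -1} : Finset ℤ),
    ∑ k ∈ Icc 1 (kBound (24 * (m : ℝ) + 1) b), (-1) ^ (k + 1) * f ((m : ℤ) + 1 - pent b k)

/-- `u₁(m) = ⌊(√(24m+1)+1)/6⌋`. -/
noncomputable def uOne (m : ℕ) : ℕ := ⌊(√(24 * (m : ℝ) + 1) + 1) / 6⌋₊

/-- `u₂(m) = ⌊(√(24m+1)-1)/6⌋`. -/
noncomputable def uTwo (m : ℕ) : ℕ := ⌊(√(24 * (m : ℝ) + 1) - 1) / 6⌋₊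

/-- The component sequence of Euler's phi function. -/
noncomputable def BPhi (m : ℕ) : ℚ :=
  (m : ℚ) + 1 - 1 / 8 * (8 - 5 * (-1) ^ uOne m
    - 4 * (-2 + (-1) ^ uOne m + (-1) ^ uTwo m) * (m : ℚ)
    + 2 * (-1) ^ uOne m * (uOne m : ℚ) * (3 * (uOne m : ℚ) + 2)
    + (-1) ^ uTwo m * (6 * (uTwo m : ℚ) ^ 2 + 8 * (uTwo m : ℚ) - 3))

/-- The component sequence of the Möbius function. -/
noncomputable def BMu (m : ℕ) : ℤ :=
  (if m = 0 then 1 else 0) + ∑ b ∈ ({1, -1} : Finset ℤ),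
    ∑ k ∈ Icc 1 (kBound (24 * (m : ℝ) + 25) b),
      (-1) ^ k * (if (m : ℤ) + 1 - pent b k = 1 then 1 else 0)

open Classical in
/-- The component sequence of Liouville's function. -/
noncomputable def BLambda : ℕ → ℤ :=
  pentSum (fun j : ℤ => if ∃ z : ℤ, √(j : ℝ) = (z : ℝ) then 1 else 0)

/-- The component sequence of von Mangoldt's function. -/
noncomputable def BVonMangoldt : ℕ → ℝ :=
  pentSum (fun j : ℤ => Real.log (j : ℝ))

/-- The component sequence of `|μ|`; here `ω(j)` is only evaluated at `j ≥ 1`. -/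
noncomputable def BAbsMu : ℕ → ℤ :=
  pentSum (fun j : ℤ => 2 ^ ArithmeticFunction.cardDistinctFactors j.toNat)

/-- The component sequence of Jordan's totient function `J_t`. -/
noncomputable def BJordan (t : ℂ) : ℕ → ℂ :=
  pentSum (fun j : ℤ => (j : ℂ) ^ t)

/-- `∑_{m=0}^{n-1} ∑_{d ∣ n} p(d-m-1) μ(n/d) B_m`. -/
noncomputable def divisorPartitionSum {R : Type*} [CommRing R] (B : ℕ → R) (n : ℕ) : R :=
  ∑ m ∈ range n, ∑ d ∈ n.divisors,
    (partitionFn ((d : ℤ) - (m : ℤ) - 1) : R) * (ArithmeticFunction.moebius (n / d) : R) * B m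

/-- The summatory function `Σ_{a,x} = ∑_{1 ≤ n ≤ x} a(n)`. -/
noncomputable def summatory {R : Type*} [CommRing R] (a : ℕ → R) (x : ℝ) : R :=
  ∑ n ∈ Icc 1 ⌊x⌋₊, a n

end ExactFormulas

namespace ExactFormulas

open Finset

section Euler

open PowerSeries PowerSeries.WithPiTopology

variable (R : Type*) [CommRing R]

/-! If `f` is the divisor sum of `a`, Möbius inversion gives `a n = ∑ μ(n/d) f(d)`. By
`pentSum_eq_coeff`, `pentSum f` lists the coefficients of the pentagonal series times `∑ f(j+1)
X^j`. Euler's pentagonal number theorem makes the partition series inverse to the pentagonal series,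
so convolving with `p` recovers `f(d)`; `divisorPartitionSum_pentSum` combines the two inversions.
What remains is to identify each divisor sum (`n`, `[n = 1]`, the square indicator, `log n`,
`2^ω(n)`, `n^t`) and to reconcile `BPhi` and `BMu` with `pentSum`. -/

/-- The generating function of Euler's partition function. -/
noncomputable def partitionSeries : PowerSeries R :=
  PowerSeries.mk fun n => (Fintype.card (Nat.Partition n) : R)

theorem partitionSeries_mul_pentagonalSeries :
    partitionSeries R * pentagonalSeries R = 1 := by
  -- The identity is algebraic; the discrete topology only gives meaning to the infinite products,
  -- whose factors cancel pairwise.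
  let _ : TopologicalSpace R := ⊥
  have _ : DiscreteTopology R := ⟨rfl⟩
  have h1 : HasProd (fun i : ℕ => ∑' j : ℕ, (X : PowerSeries R) ^ ((i + 1) * j))
      (partitionSeries R) := by
    have h := Nat.Partition.hasProd_powerSeriesMk_card_restricted R (fun _ => True)
    simpa [Nat.Partition.restricted, partitionSeries] using h
  have h2 := h1.mul (hasProd_one_sub_X_pow R)
  have h3 (i : ℕ) :
      (∑' j : ℕ, (X : PowerSeries R) ^ ((i + 1) * j)) * (1 - X ^ (i + 1)) = 1 := by
    simp_rw [pow_mul]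
    exact tsum_pow_mul_one_sub_of_constantCoeff_eq_zero (by simp)
  simp_rw [h3] at h2
  exact h2.unique hasProd_one

end Euler

/-! ### Pentagonal numbers and inversion by partitions -/

theorem two_mul_pent {b : ℤ} (hb : Odd b) (k : ℕ) :
    2 * pent b k = (k : ℤ) * (3 * (k : ℤ) + b) := by
  refine Int.two_mul_ediv_two_of_even ?_
  rw [Int.even_mul]
  by_cases hk : Even (k : ℤ)
  · exact Or.inl hk
  · right
    have hk' : Odd (k : ℤ) := by simpa using hk
    exact ((by decide : Odd (3 : ℤ)).mul hk').add_odd hb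

theorem pent_neg_one (k : ℕ) : pent (-1) k = pentagonal k := by
  have h1 := two_mul_pent (b := -1) (by decide) k
  have h2 := two_mul_natCast_pentagonal (k : ℤ)
  linarith

theorem pent_one (k : ℕ) : pent 1 k = pentagonal (-(k : ℤ)) := by
  have h1 := two_mul_pent (b := 1) (by decide) k
  have h2 := two_mul_natCast_pentagonal_neg (k : ℤ)
  linarith

/-- Completing the square: `(6k + b)² = 24 · pent b k + 1` when `b² = 1`. -/
theorem mem_Icc_kBound {b : ℤ} (hb : b = 1 ∨ b = -1) (m k : ℕ) :
    k ∈ Icc 1 (kBound (24 * (m : ℝ) + 1) b) ↔ 1 ≤ k ∧ pent b k ≤ m := by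
  rw [mem_Icc]
  refine and_congr_right fun hk => ?_
  have hodd : Odd b := by rcases hb with rfl | rfl <;> decide
  have hp := two_mul_pent hodd k
  have hsq : b ^ 2 = 1 := by rcases hb with rfl | rfl <;> norm_num
  have hkR : (1 : ℝ) ≤ k := by exact_mod_cast hk
  have hbR : (-1 : ℝ) ≤ b := by rcases hb with rfl | rfl <;> norm_num
  have hkey : pent b k ≤ m ↔ (6 * (k : ℤ) + b) ^ 2 ≤ 24 * (m : ℤ) + 1 := by
    have : (6 * (k : ℤ) + b) ^ 2 = 24 * pent b k + 1 := by linear_combination -12 * hp + hsq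
    rw [this]
    omega
  rw [kBound, Nat.le_floor_iff' (by omega), hkey, le_div_iff₀ (by norm_num), le_sub_iff_add_le,
    Real.le_sqrt' (by linarith), mul_comm]
  norm_cast

/-- The series is supported on `pentagonal k`, `k ∈ ℤ`, and `pentagonal` is injective: `b = -1`
covers `k > 0`, `b = 1` covers `k < 0`, and `k = 0` gives `F 0`. -/
theorem sum_range_coeff_pentagonalSeries {R : Type*} [CommRing R] (F : ℤ → R) (m : ℕ) :
    ∑ i ∈ range (m + 1), (PowerSeries.pentagonalSeries R).coeff i * F i =
      F 0 + ∑ b ∈ ({1, -1} : Finset ℤ),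
        ∑ k ∈ Icc 1 (kBound (24 * (m : ℝ) + 1) b), (-1) ^ k * F (pent b k) := by
  set s := Icc 1 (kBound (24 * (m : ℝ) + 1) 1) with hs
  set t := Icc 1 (kBound (24 * (m : ℝ) + 1) (-1)) with ht
  have hsm (k : ℕ) : k ∈ s ↔ 1 ≤ k ∧ pentagonal (-(k : ℤ)) ≤ m := by
    rw [hs, mem_Icc_kBound (Or.inl rfl), pent_one]
    norm_cast
  have htm (k : ℕ) : k ∈ t ↔ 1 ≤ k ∧ pentagonal (k : ℤ) ≤ m := by
    rw [ht, mem_Icc_kBound (Or.inr rfl), pent_neg_one]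
    norm_cast
  set g : ℕ → R := fun i => (PowerSeries.pentagonalSeries R).coeff i * F i with hg
  have hgs (k : ℕ) : g (pentagonal (-(k : ℤ))) = (-1) ^ k * F (pent 1 k) := by
    simp [hg, pent_one]
  have hgt (k : ℕ) : g (pentagonal (k : ℤ)) = (-1) ^ k * F (pent (-1) k) := by
    simp [hg, pent_neg_one]
  have hg0 : g (pentagonal 0) = F 0 := by
    have := hgs 0
    simpa [pent] using this
  have hU : ∑ k ∈ insert 0 (s.image (fun k : ℕ => -(k : ℤ)) ∪ t.image (fun k : ℕ => (k : ℤ))),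
      g (pentagonal k) = ∑ i ∈ range (m + 1), g i := by
    classical
    rw [← sum_image (g := pentagonal) (fun _ _ _ _ h => pentagonal_injective h)]
    refine sum_subset ?_ ?_
    · intro i hi
      simp only [mem_image, mem_insert, mem_union] at hi
      obtain ⟨k, hk, rfl⟩ := hi
      rw [mem_range, Nat.lt_succ_iff]
      rcases hk with rfl | ⟨k, hk, rfl⟩ | ⟨k, hk, rfl⟩
      · simp [pentagonal]
      · exact ((hsm k).1 hk).2
      · exact ((htm k).1 hk).2
    · intro i hi hni
      by_cases h : i ∈ Set.range pentagonal
      · obtain ⟨k, rfl⟩ := h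
        refine absurd (mem_image_of_mem _ ?_) hni
        rw [mem_range, Nat.lt_succ_iff] at hi
        simp only [mem_image, mem_insert, mem_union]
        obtain ⟨a, rfl | rfl⟩ := k.eq_nat_or_neg
        · rcases Nat.eq_zero_or_pos a with rfl | ha
          · simp
          · exact Or.inr (Or.inr ⟨a, (htm a).2 ⟨ha, hi⟩, rfl⟩)
        · rcases Nat.eq_zero_or_pos a with rfl | ha
          · simp
          · exact Or.inr (Or.inl ⟨a, (hsm a).2 ⟨ha, hi⟩, rfl⟩)
      · simp [hg, PowerSeries.coeff_pentagonalSeries_eq_zero R h]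
  rw [← hU, sum_insert, sum_union, sum_image, sum_image, hg0, sum_pair (by decide)]
  · simp_rw [hgs, hgt]
    rfl
  · intro a _ b _ h
    simpa using h
  · intro a _ b _ h
    simpa using h
  · rw [disjoint_left]
    simp only [mem_image, not_exists, not_and]
    rintro _ ⟨a, ha, rfl⟩ b hb h
    have := (hsm a).1 ha
    have := (htm b).1 hb
    omega
  · simp only [mem_union, mem_image, not_or, not_exists, not_and]
    refine ⟨fun a ha h => ?_, fun a ha h => ?_⟩
    · have := (hsm a).1 ha
      omega
    · have := (htm a).1 ha
      omega

theorem pentSum_eq_coeff {R : Type*} [CommRing R] (f : ℤ → R) (m : ℕ) :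
    pentSum f m = (PowerSeries.pentagonalSeries R *
      PowerSeries.mk fun j : ℕ => f ((j : ℤ) + 1)).coeff m := by
  have h := sum_range_coeff_pentagonalSeries (fun i => f ((m : ℤ) + 1 - i)) m
  rw [PowerSeries.coeff_mul, Nat.sum_antidiagonal_eq_sum_range_succ_mk]
  simp only [PowerSeries.coeff_mk]
  rw [pentSum, sub_eq_add_neg, ← sum_neg_distrib]
  simp_rw [← sum_neg_distrib]
  refine Eq.trans ?_ (h.symm.trans (sum_congr rfl fun i hi => ?_))
  · simp [pow_succ]
  · rw [mem_range, Nat.lt_succ_iff] at hi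
    rw [Nat.cast_sub hi, sub_add_eq_add_sub]

theorem sum_partitionFn_mul_pentSum {R : Type*} [CommRing R] (f : ℤ → R) {d n : ℕ} (hd : 1 ≤ d)
    (hdn : d ≤ n) :
    ∑ m ∈ range n, (partitionFn ((d : ℤ) - (m : ℤ) - 1) : R) * pentSum f m = f d := by
  obtain ⟨e, rfl⟩ : ∃ e, d = e + 1 := ⟨d - 1, by omega⟩
  have h : (PowerSeries.coeff e) ((PowerSeries.pentagonalSeries R *
      PowerSeries.mk fun j : ℕ => f ((j : ℤ) + 1)) * partitionSeries R) = f ((e + 1 : ℕ) : ℤ) := by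
    rw [mul_right_comm, mul_comm (PowerSeries.pentagonalSeries R),
      partitionSeries_mul_pentagonalSeries, one_mul, PowerSeries.coeff_mk]
    simp
  rw [← h, PowerSeries.coeff_mul, Nat.sum_antidiagonal_eq_sum_range_succ_mk]
  symm
  -- For `m ≥ d` the argument `d - m - 1` is negative, so `partitionFn` vanishes.
  refine sum_subset_zero_on_sdiff (range_subset_range.2 hdn) (fun m hm => ?_) fun m hm => ?_
  · simp only [mem_sdiff, mem_range] at hm
    rw [partitionFn, if_neg (by push_cast; omega)]
    simp
  · rw [mem_range] at hm
    rw [← pentSum_eq_coeff, partitionSeries, PowerSeries.coeff_mk, partitionFn,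
      if_pos (by push_cast; omega), mul_comm]
    have : (((e + 1 : ℕ) : ℤ) - (m : ℤ) - 1).toNat = e - m := by push_cast; omega
    rw [this]

/-- A sequence whose divisor sums are `f` is recovered from `pentSum f`. -/
theorem divisorPartitionSum_pentSum {R : Type*} [CommRing R] (a : ℕ → R) (f : ℤ → R)
    (h : ∀ n : ℕ, 0 < n → ∑ d ∈ n.divisors, a d = f n) {n : ℕ} (hn : 1 ≤ n) :
    a n = divisorPartitionSum (pentSum f) n := by
  have hm := (ArithmeticFunction.sum_eq_iff_sum_mul_moebius_eq (f := a)
    (g := fun k : ℕ => f k)).1 h n hn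
  rw [← hm, divisorPartitionSum, sum_comm,
    Nat.sum_divisorsAntidiagonal' fun x y => ((ArithmeticFunction.moebius x : ℤ) : R) * f y]
  refine sum_congr rfl fun d hd => ?_
  rw [← sum_partitionFn_mul_pentSum f (Nat.pos_of_mem_divisors hd) (Nat.divisor_le hd), mul_sum]
  exact sum_congr rfl fun m _ => by ring

/-! ### Closed forms and divisor sums -/

section DivisorSums

open ArithmeticFunction ArithmeticFunction.zeta

theorem BPhi_eq_pentSum : BPhi = pentSum (fun j : ℤ => (j : ℚ)) := by
  funext m
  have hb {b : ℤ} (hb : Odd b) (k : ℕ) :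
      ((pent b k : ℤ) : ℚ) = (k : ℚ) * (3 * (k : ℚ) + b) / 2 := by
    have h : ((2 * pent b k : ℤ) : ℚ) = (((k : ℤ) * (3 * (k : ℤ) + b) : ℤ) : ℚ) := by
      rw [two_mul_pent hb]
    push_cast at h
    linarith
  -- `h1` and `h2` evaluate the alternating sums for `b = -1` and `b = 1`; together they give the
  -- bracket in `BPhi`.
  have h1 (u : ℕ) : ∑ k ∈ Icc 1 u, (-1 : ℚ) ^ (k + 1) * (((m : ℤ) + 1 - pent (-1) k : ℤ) : ℚ) =
      1 / 8 * (4 * m + 5 + (-1) ^ u * (-4 * m + 6 * u ^ 2 + 4 * u - 5)) := by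
    induction u with
    | zero => simp
    | succ u ih =>
      rw [sum_Icc_succ_top (by omega), ih]
      push_cast
      rw [hb (by decide)]
      push_cast
      ring
  have h2 (u : ℕ) : ∑ k ∈ Icc 1 u, (-1 : ℚ) ^ (k + 1) * (((m : ℤ) + 1 - pent 1 k : ℤ) : ℚ) =
      1 / 8 * (4 * m + 3 + (-1) ^ u * (-4 * m + 6 * u ^ 2 + 8 * u - 3)) := by
    induction u with
    | zero => simp
    | succ u ih =>
      rw [sum_Icc_succ_top (by omega), ih]
      push_cast
      rw [hb (by decide)]
      push_cast
      ring
  have hu1 : kBound (24 * (m : ℝ) + 1) (-1) = uOne m := by simp [kBound, uOne]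
  have hu2 : kBound (24 * (m : ℝ) + 1) 1 = uTwo m := by simp [kBound, uTwo]
  rw [pentSum, sum_pair (by decide), h1, h2, hu1, hu2, BPhi]
  push_cast
  ring

/-- The larger bound replaces `m` by `m + 1`, adding only `k` with `pent b k = m + 1`, where the
indicator is tested at `0` and vanishes. -/
theorem BMu_eq_pentSum : BMu = pentSum (fun j : ℤ => if j = 1 then (1 : ℤ) else 0) := by
  funext m
  rw [BMu, pentSum, sub_eq_add_neg, ← sum_neg_distrib]
  congr 1
  · simp
  · refine sum_congr rfl fun b hb => ?_
    have hb' : b = 1 ∨ b = -1 := by simpa using hb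
    rw [← sum_neg_distrib]
    have hM : 24 * (m : ℝ) + 25 = 24 * ((m + 1 : ℕ) : ℝ) + 1 := by push_cast; ring
    symm
    refine sum_subset_zero_on_sdiff (fun k hk => ?_) (fun k hk => ?_) fun k _ => ?_
    · rw [mem_Icc_kBound hb'] at hk
      rw [hM, mem_Icc_kBound hb']
      push_cast
      omega
    · rw [mem_sdiff, hM, mem_Icc_kBound hb', mem_Icc_kBound hb'] at hk
      push_cast at hk
      rw [if_neg (by omega), mul_zero]
    · rw [pow_succ]
      ring

theorem sum_divisors_liouville {n : ℕ} (hn : n ≠ 0) :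
    ∑ d ∈ n.divisors, liouville d = if IsSquare n then 1 else 0 := by
  -- `0` is a square, so its value must be set to `0` by hand.
  let g : ArithmeticFunction ℤ := ⟨fun n => if n ≠ 0 ∧ IsSquare n then 1 else 0, by simp⟩
  have hgm : g.IsMultiplicative := by
    rw [IsMultiplicative.iff_ne_zero]
    refine ⟨by simp [g], fun {m n} hm hn h => ?_⟩
    have : IsSquare (m * n) ↔ IsSquare m ∧ IsSquare n := by
      refine ⟨fun ⟨r, hr⟩ => ⟨?_, ?_⟩, fun ⟨h1, h2⟩ => h1.mul h2⟩
      · obtain ⟨d, hd⟩ := exists_eq_pow_of_mul_eq_pow (Nat.isUnit_iff.2 h) (hr.trans (sq r).symm)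
        exact ⟨d, hd.trans (sq d)⟩
      · rw [mul_comm] at hr
        obtain ⟨d, hd⟩ := exists_eq_pow_of_mul_eq_pow (Nat.isUnit_iff.2 h.symm)
          (hr.trans (sq r).symm)
        exact ⟨d, hd.trans (sq d)⟩
    by_cases h1 : IsSquare m <;> by_cases h2 : IsSquare n <;> simp [g, hm, hn, this, h1, h2]
  have hz : ((ζ : ArithmeticFunction ℕ) : ArithmeticFunction ℤ).IsMultiplicative :=
    isMultiplicative_zeta.natCast
  have h : liouville * (ζ : ArithmeticFunction ℤ) = g := by
    rw [(isMultiplicative_liouville.mul hz).eq_iff_eq_on_prime_powers _ _ hgm]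
    intro p k hp
    rw [coe_mul_zeta_apply, Nat.sum_divisors_prime_pow hp]
    have h1 (i : ℕ) : liouville (p ^ i) = (-1) ^ i := by
      rw [liouville_apply (pow_ne_zero _ hp.ne_zero), cardFactors_apply_prime_pow hp]
    have h2 : IsSquare (p ^ k) ↔ Even k := by
      refine ⟨fun ⟨r, hr⟩ => ?_, fun hk => hk.isSquare_pow p⟩
      have hr0 : r ≠ 0 := fun h => pow_ne_zero k hp.ne_zero (by simpa [h] using hr)
      have := congrArg (fun x => x.factorization p) hr
      simp only [hp.factorization_pow, Finsupp.single_eq_same,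
        Nat.factorization_mul hr0 hr0, Finsupp.add_apply] at this
      exact ⟨_, this⟩
    simp only [h1, g, coe_mk, h2]
    -- At `p ^ k` the sum of `(-1)^i` over `i ≤ k` is `1` exactly for even `k`.
    rw [neg_one_geom_sum]
    by_cases hk : Even k <;> simp [hp.ne_zero, Nat.even_add_one, hk]
  have := congrArg (fun F => F n) h
  rw [coe_mul_zeta_apply] at this
  simpa [g, hn] using this

theorem sum_divisors_abs_moebius {n : ℕ} (hn : n ≠ 0) :
    ∑ d ∈ n.divisors, |moebius d| = 2 ^ cardDistinctFactors n := by
  simp_rw [abs_moebius]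
  -- Squarefree divisors correspond to sets of prime factors.
  rw [← sum_filter, Nat.sum_divisors_filter_squarefree hn]
  have : (UniqueFactorizationMonoid.normalizedFactors n).toFinset = n.primeFactors := by
    rw [Nat.factors_eq]
    rfl
  rw [this, sum_const, card_powerset, nsmul_eq_mul, mul_one, cardDistinctFactors_apply,
    ← List.card_toFinset]
  norm_cast

theorem sum_divisors_jordanTotient (t : ℂ) {n : ℕ} (hn : n ≠ 0) :
    ∑ d ∈ n.divisors, jordanTotient t d = (n : ℂ) ^ t := by
  let J : ArithmeticFunction ℂ := ⟨fun n => if n = 0 then 0 else jordanTotient t n, by simp⟩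
  let g : ArithmeticFunction ℂ := ⟨fun n => if n = 0 then 0 else (n : ℂ) ^ t, by simp⟩
  have hgm : g.IsMultiplicative := by
    rw [IsMultiplicative.iff_ne_zero]
    refine ⟨by simp [g], fun {m n} hm hn _ => ?_⟩
    simp [g, hm, hn, Complex.natCast_mul_natCast_cpow]
  have hJm : J.IsMultiplicative := by
    rw [IsMultiplicative.iff_ne_zero]
    refine ⟨by simp [J, jordanTotient], fun {m n} hm hn h => ?_⟩
    simp only [J, coe_mk, hm, hn, mul_eq_zero, or_self, if_false, jordanTotient]
    rw [h.primeFactors_mul, prod_union h.disjoint_primeFactors, Nat.cast_mul,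
      Complex.natCast_mul_natCast_cpow]
    ring
  have hz : ((ζ : ArithmeticFunction ℕ) : ArithmeticFunction ℂ).IsMultiplicative :=
    isMultiplicative_zeta.natCast
  have h : J * (ζ : ArithmeticFunction ℂ) = g := by
    rw [(hJm.mul hz).eq_iff_eq_on_prime_powers _ _ hgm]
    intro p k hp
    have hp0 := hp.ne_zero
    rw [coe_mul_zeta_apply, Nat.sum_divisors_prime_pow hp]
    induction k with
    | zero => simp [J, g, jordanTotient]
    | succ k ih =>
      rw [sum_range_succ, ih]
      simp only [J, g, coe_mk, pow_ne_zero _ hp0, if_false, jordanTotient,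
        Nat.primeFactors_prime_pow (Nat.succ_ne_zero k) hp, prod_singleton]
      have hpC : (p : ℂ) ≠ 0 := by exact_mod_cast hp0
      have hinv : (p : ℂ) ^ t * (p : ℂ) ^ (-t) = 1 := by
        rw [← Complex.cpow_add _ _ hpC, add_neg_cancel, Complex.cpow_zero]
      rw [pow_succ, Nat.cast_mul, Complex.natCast_mul_natCast_cpow]
      -- Telescoping: `J_t(p^(k+1)) = p^((k+1)t) - p^(kt)`.
      linear_combination -(((p ^ k : ℕ) : ℂ) ^ t) * hinv
  have := congrArg (fun F => F n) h
  rw [coe_mul_zeta_apply] at this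
  simp only [g, coe_mk, if_neg hn] at this
  rw [← this]
  exact sum_congr rfl fun d hd => by simp [J, (Nat.pos_of_mem_divisors hd).ne']

theorem exists_sqrt_natCast_eq_intCast_iff (n : ℕ) :
    (∃ z : ℤ, √(((n : ℤ) : ℝ)) = (z : ℝ)) ↔ IsSquare n := by
  constructor
  · rintro ⟨z, hz⟩
    have hz0 : 0 ≤ z := by exact_mod_cast hz ▸ Real.sqrt_nonneg _
    lift z to ℕ using hz0
    rw [Real.sqrt_eq_iff_mul_self_eq (by positivity) (by positivity)] at hz
    exact ⟨z, by exact_mod_cast hz⟩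
  · rintro ⟨r, rfl⟩
    exact ⟨r, by push_cast; exact Real.sqrt_mul_self (by positivity)⟩

end DivisorSums

/-! ### The individual formulas -/

theorem totient_eq {n : ℕ} (hn : 1 ≤ n) :
    (Nat.totient n : ℚ) = divisorPartitionSum BPhi n := by
  rw [BPhi_eq_pentSum]
  refine divisorPartitionSum_pentSum (fun n => (Nat.totient n : ℚ)) _ (fun k _ => ?_) hn
  exact_mod_cast Nat.sum_totient k

theorem moebius_eq {n : ℕ} (hn : 1 ≤ n) :
    ArithmeticFunction.moebius n = divisorPartitionSum BMu n := by
  rw [BMu_eq_pentSum]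
  refine divisorPartitionSum_pentSum (fun n => ArithmeticFunction.moebius n) _ (fun k _ => ?_) hn
  rw [← ArithmeticFunction.coe_mul_zeta_apply, ArithmeticFunction.moebius_mul_coe_zeta,
    ArithmeticFunction.one_apply]
  norm_cast

theorem liouville_eq {n : ℕ} (hn : 1 ≤ n) :
    ArithmeticFunction.liouville n = divisorPartitionSum BLambda n := by
  refine divisorPartitionSum_pentSum (fun n => ArithmeticFunction.liouville n) _
    (fun k hk => ?_) hn
  rw [sum_divisors_liouville hk.ne']
  simp only [exists_sqrt_natCast_eq_intCast_iff]

theorem vonMangoldt_eq {n : ℕ} (hn : 1 ≤ n) :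
    ArithmeticFunction.vonMangoldt n = divisorPartitionSum BVonMangoldt n := by
  refine divisorPartitionSum_pentSum (fun n => ArithmeticFunction.vonMangoldt n) _
    (fun k _ => ?_) hn
  rw [ArithmeticFunction.vonMangoldt_sum]
  simp

theorem abs_moebius_eq {n : ℕ} (hn : 1 ≤ n) :
    |ArithmeticFunction.moebius n| = divisorPartitionSum BAbsMu n := by
  refine divisorPartitionSum_pentSum (fun n => |ArithmeticFunction.moebius n|) _
    (fun k hk => ?_) hn
  simp [sum_divisors_abs_moebius hk.ne']

theorem jordanTotient_eq (t : ℂ) {n : ℕ} (hn : 1 ≤ n) :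
    jordanTotient t n = divisorPartitionSum (BJordan t) n := by
  refine divisorPartitionSum_pentSum (jordanTotient t) _ (fun k hk => ?_) hn
  simp [sum_divisors_jordanTotient t hk.ne']

theorem summatory_congr {R : Type*} [CommRing R] {a b : ℕ → R} (h : ∀ n : ℕ, 1 ≤ n → a n = b n)
    (x : ℝ) : summatory a x = summatory b x :=
  sum_congr rfl fun n hn => h n (mem_Icc.1 hn).1

end ExactFormulas

theorem mainTheorem2 :
    (∀ n : ℕ, 1 ≤ n →
      (Nat.totient n : ℚ) = ExactFormulas.divisorPartitionSum ExactFormulas.BPhi n ∧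
      ArithmeticFunction.moebius n = ExactFormulas.divisorPartitionSum ExactFormulas.BMu n ∧
      ArithmeticFunction.liouville n =
        ExactFormulas.divisorPartitionSum ExactFormulas.BLambda n ∧
      ArithmeticFunction.vonMangoldt n =
        ExactFormulas.divisorPartitionSum ExactFormulas.BVonMangoldt n ∧
      |ArithmeticFunction.moebius n| =
        ExactFormulas.divisorPartitionSum ExactFormulas.BAbsMu n ∧
      ∀ t : ℂ, ExactFormulas.jordanTotient t n =
        ExactFormulas.divisorPartitionSum (ExactFormulas.BJordan t) n) ∧
    (∀ x : ℝ,
      ExactFormulas.summatory (fun n => (Nat.totient n : ℚ)) x =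
        ExactFormulas.summatory (ExactFormulas.divisorPartitionSum ExactFormulas.BPhi) x ∧
      ExactFormulas.summatory (fun n => ArithmeticFunction.moebius n) x =
        ExactFormulas.summatory (ExactFormulas.divisorPartitionSum ExactFormulas.BMu) x ∧
      ExactFormulas.summatory (fun n => ArithmeticFunction.liouville n) x =
        ExactFormulas.summatory (ExactFormulas.divisorPartitionSum ExactFormulas.BLambda) x ∧
      ExactFormulas.summatory (fun n => ArithmeticFunction.vonMangoldt n) x =
        ExactFormulas.summatory (ExactFormulas.divisorPartitionSum ExactFormulas.BVonMangoldt) x ∧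
      ExactFormulas.summatory (fun n => |ArithmeticFunction.moebius n|) x =
        ExactFormulas.summatory (ExactFormulas.divisorPartitionSum ExactFormulas.BAbsMu) x ∧
      ∀ t : ℂ, ExactFormulas.summatory (ExactFormulas.jordanTotient t) x =
        ExactFormulas.summatory
          (ExactFormulas.divisorPartitionSum (ExactFormulas.BJordan t)) x) := by
  refine ⟨fun n hn => ⟨ExactFormulas.totient_eq hn, ExactFormulas.moebius_eq hn,
    ExactFormulas.liouville_eq hn, ExactFormulas.vonMangoldt_eq hn,
    ExactFormulas.abs_moebius_eq hn, fun t => ExactFormulas.jordanTotient_eq t hn⟩, fun x =>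
    ⟨?_, ?_, ?_, ?_, ?_, fun t => ?_⟩⟩ <;> apply ExactFormulas.summatory_congr <;> intro n hn
  · exact ExactFormulas.totient_eq hn
  · exact ExactFormulas.moebius_eq hn
  · exact ExactFormulas.liouville_eq hn
  · exact ExactFormulas.vonMangoldt_eq hn
  · exact ExactFormulas.abs_moebius_eq hn
  · exact ExactFormulas.jordanTotient_eq t hn
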